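/- Let $\mathscr H$ be a complex Hilbert space with inner product $(\cdot\mid\cdot)$, let $\mathbb B(\mathscr H)$ be the algebra of bounded linear operators on $\mathscr H$ with the operator norm, let $T_1,T_2\in\mathbb B(\mathscr H)$ and $\varepsilon\in[0,1)$. For $S,T\in\mathbb B(\mathscr H)$ write $S\parallel^{\varepsilon}T$ if $\inf\{\|S+\mu T\| : \mu\in\mathbb C\}\le\varepsilon\|S\|$. Then the following statements are equivalent: (i) $T_1\parallel^{\varepsilon}T_2$; (ii) $T_1^*\parallel^{\varepsilon}T_2^*$; (iii) $\alpha T_1\parallel^{\varepsilon}\beta T_2$ for all (equivalently, for some) $\alpha,\beta\in\mathbb C\setminus\{0\}$; (iv) $\sup\{|(T_1\xi\mid\eta)| : \xi,\eta\in\mathscr H,\ \|\xi\|=\|\eta\|=1,\ (T_2\xi\mid\eta)=0\}\le\varepsilon\|T_1\|$, where the supremum of the empty set is $0$. Moreover, each of these conditions implies (v) $|(T_1\xi\mid T_2\xi)|^2\ge\|T_1\xi\|^2\|T_2\xi\|^2-\varepsilon^2\|T_1\|^2\|T_2\|^2$ for all $\xi\in\mathscr H$ with $\|\xi\|=1$.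 -/

import Mathlib

/-- `x` is `ε`-parallel to `y` in a complex normed space:
`inf {‖x + μ y‖ : μ ∈ ℂ} ≤ ε ‖x‖`. -/
def ApproxParallel {V : Type*} [NormedAddCommGroup V] [NormedSpace ℂ V]
    (ε : ℝ) (x y : V) : Prop :=
  sInf {r : ℝ | ∃ μ : ℂ, r = ‖x + μ • y‖} ≤ ε * ‖x‖

/-- The set `{|(T₁ξ|η)| : ‖ξ‖ = ‖η‖ = 1, (T₂ξ|η) = 0}`. The inner product `(u|v)`, linear in its
first variable, is `inner ℂ v u`. The set is bounded above by `‖T₁‖`; where it is empty, its real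
supremum is `0`, the supremum of the empty set in `[0, ∞)`. -/
def orthValues {H : Type*} [NormedAddCommGroup H] [InnerProductSpace ℂ H]
    (T₁ T₂ : H →L[ℂ] H) : Set ℝ :=
  {r : ℝ | ∃ ξ η : H, ‖ξ‖ = 1 ∧ ‖η‖ = 1 ∧ inner ℂ η (T₂ ξ) = 0 ∧ r = ‖inner ℂ η (T₁ ξ)‖}

/-- `|(T₁ξ|T₂ξ)|² ≥ ‖T₁ξ‖² ‖T₂ξ‖² - ε² ‖T₁‖² ‖T₂‖²` for all unit vectors `ξ`. -/
def ReverseCauchySchwarz {H : Type*} [NormedAddCommGroup H] [InnerProductSpace ℂ H]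
    (ε : ℝ) (T₁ T₂ : H →L[ℂ] H) : Prop :=
  ∀ ξ : H, ‖ξ‖ = 1 →
    ‖inner ℂ (T₂ ξ) (T₁ ξ)‖ ^ 2 ≥
      ‖T₁ ξ‖ ^ 2 * ‖T₂ ξ‖ ^ 2 - ε ^ 2 * ‖T₁‖ ^ 2 * ‖T₂‖ ^ 2

/-!
The infimum of `‖T₁ + μ T₂‖` over `μ` is attained, so `(i)` says that `‖T₁ + μ T₂‖ ≤ ε ‖T₁‖` for
some `μ`, and `(ii)`, `(iii)` only reparametrize `μ`. The Gram determinant of `u, v` does not change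
when `u` is replaced by `u + μ v`, which gives `(v)`.

Condition `(iv)` says that every unit vector `ξ` has its own `μ` with `‖T₁ ξ + μ T₂ ξ‖ ≤ ε ‖T₁‖`,
and the point is to choose `μ` independently of `ξ`. For fixed `ξ` the admissible `μ` form a closed
set, compact if `T₂ ξ ≠ 0`, so by the finite intersection property it is enough to do this on
finite-dimensional subspaces. There, let `μ` minimize `‖T₁ + μ T₂‖`, and put `A = T₁ + μ T₂`.
Perturbing `A` in each direction of `ℂ T₂` and using the convexity of the numerical range of `T₂* A`
on the subspace where `A` attains its norm, one finds a unit vector `ξ` with `‖A ξ‖ = ‖A‖` and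
`T₂ ξ ⊥ A ξ` (the Bhatia–Šemrl theorem). By Pythagoras `‖A‖ = ‖A ξ‖` is the distance from `T₁ ξ` to
`ℂ T₂ ξ`, which is at most `ε ‖T₁‖`.
-/

open Filter Topology
open scoped InnerProductSpace

section Line

variable {𝕜 V : Type*} [NontriviallyNormedField 𝕜] [ProperSpace 𝕜]
  [NormedAddCommGroup V] [NormedSpace 𝕜 V]

theorem isCompact_setOf_norm_add_smul_le (x : V) {y : V} (hy : y ≠ 0) (r : ℝ) :
    IsCompact {μ : 𝕜 | ‖x + μ • y‖ ≤ r} := by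
  refine Metric.isCompact_of_isClosed_isBounded (isClosed_le (by fun_prop) continuous_const) ?_
  refine isBounded_iff_forall_norm_le.2 ⟨(r + ‖x‖) / ‖y‖, fun μ hμ => ?_⟩
  rw [le_div_iff₀ (norm_pos_iff.2 hy), ← norm_smul]
  calc ‖μ • y‖ = ‖x + μ • y - x‖ := by rw [add_sub_cancel_left]
    _ ≤ ‖x + μ • y‖ + ‖x‖ := norm_sub_le _ _
    _ ≤ r + ‖x‖ := by gcongr; exact hμ

variable (𝕜) in
theorem exists_forall_norm_add_smul_le (x y : V) :
    ∃ μ : 𝕜, ∀ ν : 𝕜, ‖x + μ • y‖ ≤ ‖x + ν • y‖ := by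
  rcases eq_or_ne y 0 with rfl | hy
  · exact ⟨0, by simp⟩
  · refine Continuous.exists_forall_le' (by fun_prop) 0 ?_
    filter_upwards [(isCompact_setOf_norm_add_smul_le x hy ‖x + (0 : 𝕜) • y‖).compl_mem_cocompact]
      with ν hν
    exact le_of_not_ge hν

end Line

section ApproxParallel

variable {V : Type*} [NormedAddCommGroup V] [NormedSpace ℂ V] {ε : ℝ} {x y : V}

theorem approxParallel_iff_exists_norm_add_smul_le :
    ApproxParallel ε x y ↔ ∃ μ : ℂ, ‖x + μ • y‖ ≤ ε * ‖x‖ := by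
  obtain ⟨μ, hμ⟩ := exists_forall_norm_add_smul_le ℂ x y
  have hleast : IsLeast {r : ℝ | ∃ ν : ℂ, r = ‖x + ν • y‖} ‖x + μ • y‖ :=
    ⟨⟨μ, rfl⟩, by rintro _ ⟨ν, rfl⟩; exact hμ ν⟩
  rw [ApproxParallel, hleast.csInf_eq]
  exact ⟨fun h => ⟨μ, h⟩, fun ⟨ν, hν⟩ => (hμ ν).trans hν⟩

theorem ApproxParallel.const_smul (h : ApproxParallel ε x y) (α : ℂ) {β : ℂ} (hβ : β ≠ 0) :
    ApproxParallel ε (α • x) (β • y) := by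
  rw [approxParallel_iff_exists_norm_add_smul_le] at h ⊢
  obtain ⟨μ, hμ⟩ := h
  refine ⟨α * μ * β⁻¹, ?_⟩
  rw [smul_smul, inv_mul_cancel_right₀ hβ, mul_smul, ← smul_add, norm_smul, norm_smul,
    mul_left_comm]
  gcongr

theorem approxParallel_smul_smul_iff {α β : ℂ} (hα : α ≠ 0) (hβ : β ≠ 0) :
    ApproxParallel ε (α • x) (β • y) ↔ ApproxParallel ε x y := by
  refine ⟨fun h => ?_, fun h => h.const_smul α hβ⟩
  simpa only [inv_smul_smul₀ hα, inv_smul_smul₀ hβ] using h.const_smul α⁻¹ (inv_ne_zero hβ)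

theorem approxParallel_map_conjLinear_iff {W : Type*} [NormedAddCommGroup W] [NormedSpace ℂ W]
    (e : V ≃ₗᵢ⋆[ℂ] W) : ApproxParallel ε (e x) (e y) ↔ ApproxParallel ε x y := by
  have hnorm (μ : ℂ) : ‖e x + starRingEnd ℂ μ • e y‖ = ‖x + μ • y‖ := by
    rw [← map_smulₛₗ, ← map_add, e.norm_map]
  rw [approxParallel_iff_exists_norm_add_smul_le, approxParallel_iff_exists_norm_add_smul_le,
    (starRingAut (R := ℂ)).surjective.exists]
  simp only [starRingAut_apply, ← starRingEnd_apply, hnorm, e.norm_map]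

end ApproxParallel

section InnerProduct

variable {𝕜 E : Type*} [RCLike 𝕜] [NormedAddCommGroup E] [InnerProductSpace 𝕜 E]

theorem norm_le_norm_add_smul_of_inner_eq_zero {u v : E} (h : ⟪v, u⟫_𝕜 = 0) (μ : 𝕜) :
    ‖u‖ ≤ ‖u + μ • v‖ := by
  have hu : ⟪u, μ • v⟫_𝕜 = 0 := by rw [inner_smul_right, inner_eq_zero_symm.1 h, mul_zero]
  refine le_of_sq_le_sq ?_ (norm_nonneg _)
  rw [norm_add_sq (𝕜 := 𝕜), hu, map_zero]
  linarith [sq_nonneg ‖μ • v‖]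

theorem norm_add_smul_sq_mul_norm_sq_sub_norm_inner_sq (u v : E) (μ : 𝕜) :
    ‖u + μ • v‖ ^ 2 * ‖v‖ ^ 2 - ‖⟪v, u + μ • v⟫_𝕜‖ ^ 2 =
      ‖u‖ ^ 2 * ‖v‖ ^ 2 - ‖⟪v, u⟫_𝕜‖ ^ 2 := by
  have hcross : RCLike.re ⟪⟪v, u⟫_𝕜, μ * (‖v‖ ^ 2 : ℝ)⟫_𝕜 = RCLike.re ⟪u, μ • v⟫_𝕜 * ‖v‖ ^ 2 := by
    rw [RCLike.inner_apply, inner_conj_symm, inner_smul_right, mul_right_comm,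
      RCLike.re_mul_ofReal]
  have hinner : ⟪v, u + μ • v⟫_𝕜 = ⟪v, u⟫_𝕜 + μ * (‖v‖ ^ 2 : ℝ) := by
    rw [inner_add_right, inner_smul_right, inner_self_eq_norm_sq_to_K, RCLike.ofReal_pow]
  rw [hinner, norm_add_sq (𝕜 := 𝕜) ⟪v, u⟫_𝕜, norm_add_sq (𝕜 := 𝕜) u, hcross, norm_mul, norm_smul,
    RCLike.norm_of_nonneg (sq_nonneg ‖v‖)]
  ring

theorem norm_sq_mul_norm_sq_sub_norm_inner_sq_le (u v : E) (μ : 𝕜) :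
    ‖u‖ ^ 2 * ‖v‖ ^ 2 - ‖⟪v, u⟫_𝕜‖ ^ 2 ≤ ‖u + μ • v‖ ^ 2 * ‖v‖ ^ 2 := by
  rw [← norm_add_smul_sq_mul_norm_sq_sub_norm_inner_sq u v μ]
  exact sub_le_self _ (sq_nonneg _)

variable (𝕜) in
theorem exists_inner_add_smul_eq_zero (u v : E) : ∃ μ : 𝕜, ⟪v, u + μ • v⟫_𝕜 = 0 := by
  rcases eq_or_ne v 0 with rfl | hv
  · exact ⟨0, inner_zero_left _⟩
  · refine ⟨-(⟪v, u⟫_𝕜 / ⟪v, v⟫_𝕜), ?_⟩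
    rw [inner_add_right, inner_smul_right, neg_mul, div_mul_cancel₀ _ (inner_self_ne_zero.2 hv),
      add_neg_cancel]

theorem exists_norm_add_smul_le_of_norm_inner_le {u v : E} {s : ℝ} (hs : 0 ≤ s)
    (h : ∀ y : E, ‖y‖ = 1 → ⟪y, v⟫_𝕜 = 0 → ‖⟪y, u⟫_𝕜‖ ≤ s) : ∃ μ : 𝕜, ‖u + μ • v‖ ≤ s := by
  obtain ⟨μ, hμ⟩ := exists_inner_add_smul_eq_zero 𝕜 u v
  refine ⟨μ, ?_⟩
  set w : E := u + μ • v with hw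
  rcases eq_or_ne w 0 with hw₀ | hw₀
  · rwa [hw₀, norm_zero]
  have hwv : ⟪w, v⟫_𝕜 = 0 := inner_eq_zero_symm.1 hμ
  have hwu : ⟪w, u⟫_𝕜 = (‖w‖ : 𝕜) ^ 2 := by
    rw [← inner_self_eq_norm_sq_to_K, eq_sub_of_add_eq hw.symm, inner_sub_right, inner_smul_right,
      hwv, mul_zero, sub_zero]
  have hunit := h ((‖w‖⁻¹ : 𝕜) • w) (norm_smul_inv_norm hw₀)
    (by rw [inner_smul_left, hwv, mul_zero])
  rwa [inner_smul_left, hwu, norm_mul, RCLike.norm_conj, norm_inv, norm_pow, RCLike.norm_ofReal,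
    abs_norm, sq, inv_mul_cancel_left₀ (norm_ne_zero_iff.2 hw₀)] at hunit

theorem norm_inner_apply_le_opNorm {V : Type*} [SeminormedAddCommGroup V] [NormedSpace 𝕜 V]
    (T : V →L[𝕜] E) {x : V} {y : E} (hx : ‖x‖ = 1) (hy : ‖y‖ = 1) : ‖⟪y, T x⟫_𝕜‖ ≤ ‖T‖ :=
  calc ‖⟪y, T x⟫_𝕜‖ ≤ ‖y‖ * ‖T x‖ := norm_inner_le_norm _ _
    _ = ‖T x‖ := by rw [hy, one_mul]
    _ ≤ ‖T‖ := T.unit_le_opNorm x hx.le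

end InnerProduct

section ToeplitzHausdorff

variable {E : Type*} [NormedAddCommGroup E]

theorem exists_norm_eq_one_conj_mul_add_mul_im_eq_zero (a b : ℂ) :
    ∃ c : ℂ, ‖c‖ = 1 ∧ (starRingEnd ℂ c * a + c * b).im = 0 := by
  obtain ⟨c, hc, hreal⟩ := RCLike.exists_norm_eq_mul_self (b - starRingEnd ℂ a)
  refine ⟨c, hc, ?_⟩
  have him := congrArg Complex.im hreal
  simp only [Complex.coe_algebraMap, Complex.ofReal_im, Complex.mul_im, Complex.sub_im,
    Complex.sub_re, Complex.conj_re, Complex.conj_im, Complex.add_im] at him ⊢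
  linarith

/-- The numerical range of a sesquilinear form: its values on the diagonal of the unit sphere. For
the form `(x, y) ↦ ⟪x, T y⟫` it is the usual numerical range of the operator `T`. -/
def numericalRange [NormedSpace ℂ E] (φ : E →ₗ⋆[ℂ] E →ₗ[ℂ] ℂ) : Set ℂ :=
  (fun x => φ x x) '' Metric.sphere 0 1

theorem mem_numericalRange_of_apply_self_eq [NormedSpace ℂ E] {φ : E →ₗ⋆[ℂ] E →ₗ[ℂ] ℂ} {x : E}
    (hx : x ≠ 0) {z : ℂ} (h : φ x x = z * (‖x‖ : ℂ) ^ 2) : z ∈ numericalRange φ := by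
  have hx' : (‖x‖ : ℂ) ≠ 0 := Complex.ofReal_ne_zero.2 (norm_ne_zero_iff.2 hx)
  refine ⟨(‖x‖⁻¹ : ℂ) • x, mem_sphere_zero_iff_norm.2 (norm_smul_inv_norm hx), ?_⟩
  simp only [map_smulₛₗ, LinearMap.smul_apply, smul_eq_mul, h, map_inv₀, Complex.conj_ofReal,
    RingHom.id_apply]
  field_simp

theorem ofReal_mem_numericalRange [NormedSpace ℂ E] {φ : E →ₗ⋆[ℂ] E →ₗ[ℂ] ℂ}
    (h₀ : 0 ∈ numericalRange φ) (h₁ : 1 ∈ numericalRange φ) {l : ℝ} (hl : l ∈ Set.Icc (0 : ℝ) 1) :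
    (l : ℂ) ∈ numericalRange φ := by
  obtain ⟨x₀, hx₀, hφ₀ : φ x₀ x₀ = 0⟩ := h₀
  obtain ⟨x₁, hx₁, hφ₁ : φ x₁ x₁ = 1⟩ := h₁
  rw [mem_sphere_zero_iff_norm] at hx₀ hx₁
  obtain ⟨c, hc, him⟩ := exists_norm_eq_one_conj_mul_add_mul_im_eq_zero (φ x₁ x₀) (φ x₀ x₁)
  let k : ℝ := (starRingEnd ℂ c * φ x₁ x₀ + c * φ x₀ x₁).re
  have hcross : starRingEnd ℂ c * φ x₁ x₀ + c * φ x₀ x₁ = k := Complex.ext rfl him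
  have hcc : starRingEnd ℂ c * c = 1 := by rw [Complex.conj_mul', hc]; simp
  let y (t : ℝ) : E := ((1 - t : ℝ) : ℂ) • x₀ + (t : ℂ) • c • x₁
  have hφy (t : ℝ) : φ (y t) (y t) = (t ^ 2 + t * (1 - t) * k : ℝ) := by
    simp only [y, map_add, map_smulₛₗ, LinearMap.add_apply, LinearMap.smul_apply, smul_eq_mul, hφ₀,
      hφ₁, Complex.conj_ofReal, RingHom.id_apply]
    push_cast
    linear_combination (t : ℂ) * (1 - t) * hcross + (t : ℂ) ^ 2 * hcc
  obtain ⟨t, -, ht⟩ : (0 : ℝ) ∈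
      (fun t : ℝ => t ^ 2 + t * (1 - t) * k - l * ‖y t‖ ^ 2) '' Set.Icc 0 1 := by
    apply intermediate_value_Icc zero_le_one (by fun_prop)
    simp [y, norm_smul, hx₀, hx₁, hc, hl.1, hl.2]
  -- If `y t = 0`, then `t • c • x₁` is a multiple of `x₀`, where `φ` vanishes, forcing `t = 0`.
  have hy : y t ≠ 0 := by
    intro hy
    have heq : ((1 - t : ℝ) : ℂ) • x₀ = -((t : ℂ) • c • x₁) := eq_neg_of_add_eq_zero_left hy
    have ht₀ : t = 0 := by
      have hφeq := congrArg (fun x => φ x x) heq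
      simp only [map_neg, LinearMap.neg_apply, map_smulₛₗ, LinearMap.smul_apply, smul_eq_mul, hφ₀,
        hφ₁, Complex.conj_ofReal, RingHom.id_apply] at hφeq
      have hsq : (t : ℂ) ^ 2 = 0 := by linear_combination -hφeq - (t : ℂ) ^ 2 * hcc
      exact Complex.ofReal_eq_zero.1 (pow_eq_zero_iff two_ne_zero |>.1 hsq)
    have hx₀' : x₀ = 0 := by simpa [ht₀] using heq
    simp [hx₀'] at hx₀
  refine mem_numericalRange_of_apply_self_eq hy ?_
  rw [hφy, sub_eq_zero.1 ht]
  push_cast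
  rfl

-- The Toeplitz–Hausdorff theorem, by an affine change of `φ` that moves the two values to `0`, `1`.
theorem convex_numericalRange [InnerProductSpace ℂ E] (φ : E →ₗ⋆[ℂ] E →ₗ[ℂ] ℂ) :
    Convex ℝ (numericalRange φ) := by
  rintro z₀ ⟨x₀, hx₀, hφ₀ : φ x₀ x₀ = z₀⟩ z₁ ⟨x₁, hx₁, hφ₁ : φ x₁ x₁ = z₁⟩ a l ha hl hal
  obtain rfl : a = 1 - l := by linarith
  rcases eq_or_ne z₁ z₀ with rfl | hne
  · rw [← add_smul, hal, one_smul]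
    exact ⟨x₀, hx₀, hφ₀⟩
  have hne' : z₁ - z₀ ≠ 0 := sub_ne_zero.2 hne
  let ψ : E →ₗ⋆[ℂ] E →ₗ[ℂ] ℂ := (z₁ - z₀)⁻¹ • (φ - z₀ • innerₛₗ ℂ)
  have hψ {x : E} (hx : x ∈ Metric.sphere 0 1) : ψ x x = (z₁ - z₀)⁻¹ * (φ x x - z₀) := by
    simp [ψ, inner_self_eq_norm_sq_to_K, mem_sphere_zero_iff_norm.1 hx]
  obtain ⟨x, hx, hψx : ψ x x = l⟩ : (l : ℂ) ∈ numericalRange ψ :=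
    ofReal_mem_numericalRange ⟨x₀, hx₀, by simp [hψ hx₀, hφ₀]⟩
      ⟨x₁, hx₁, by simp [hψ hx₁, hφ₁, hne']⟩ ⟨hl, sub_nonneg.1 ha⟩
  refine ⟨x, hx, ?_⟩
  rw [hψ hx, inv_mul_eq_iff_eq_mul₀ hne'] at hψx
  simp only [Complex.real_smul, Complex.ofReal_sub, Complex.ofReal_one]
  linear_combination hψx

theorem zero_mem_of_forall_exists_inner_nonpos {V : Type*} [NormedAddCommGroup V]
    [InnerProductSpace ℝ V] {K : Set V} (hcomplete : IsComplete K) (hconvex : Convex ℝ K)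
    (h : ∀ v : V, ∃ w ∈ K, ⟪v, w⟫_ℝ ≤ 0) : (0 : V) ∈ K := by
  obtain ⟨w₀, hw₀, -⟩ := h 0
  obtain ⟨v, hv, hmin⟩ := exists_norm_eq_iInf_of_complete_convex ⟨w₀, hw₀⟩ hcomplete hconvex 0
  rw [norm_eq_iInf_iff_real_inner_le_zero hconvex hv] at hmin
  obtain ⟨w, hw, hvw⟩ := h v
  have hle : ⟪v, v⟫_ℝ ≤ ⟪v, w⟫_ℝ := by
    have := hmin w hw
    rw [zero_sub, inner_neg_left, inner_sub_right] at this
    linarith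
  have hv₀ : v = 0 := real_inner_self_nonpos.1 (hle.trans hvw)
  exact hv₀ ▸ hv

end ToeplitzHausdorff

section NormAttaining

variable {𝕜 E F : Type*} [RCLike 𝕜] [NormedAddCommGroup E] [NormedAddCommGroup F]

theorem exists_unit_norm_apply_eq_norm [NormedSpace 𝕜 E] [NormedSpace 𝕜 F] [Nontrivial E]
    [FiniteDimensional 𝕜 E] (A : E →L[𝕜] F) : ∃ x : E, ‖x‖ = 1 ∧ ‖A x‖ = ‖A‖ := by
  let _ : NormedSpace ℝ E := NormedSpace.restrictScalars ℝ 𝕜 E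
  have : ProperSpace E := FiniteDimensional.proper_rclike 𝕜 E
  obtain ⟨x, hx, hmax⟩ := (isCompact_sphere (0 : E) 1).exists_sSup_image_eq
    (NormedSpace.sphere_nonempty.2 zero_le_one) (f := fun x => ‖A x‖) (by fun_prop)
  exact ⟨x, mem_sphere_zero_iff_norm.1 hx, hmax.symm.trans A.sSup_sphere_eq_norm⟩

theorem exists_norming_re_inner_nonpos [NormedSpace 𝕜 E] [InnerProductSpace 𝕜 F] [Nontrivial E]
    [FiniteDimensional 𝕜 E] {A C : E →L[𝕜] F}
    (h : ∀ t : ℝ, 0 < t → ‖A‖ ≤ ‖A - (t : 𝕜) • C‖) :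
    ∃ x : E, ‖x‖ = 1 ∧ ‖A x‖ = ‖A‖ ∧ RCLike.re ⟪C x, A x⟫_𝕜 ≤ 0 := by
  have : ProperSpace E := FiniteDimensional.proper_rclike 𝕜 E
  let t (n : ℕ) : ℝ := 1 / (n + 1)
  have ht (n : ℕ) : 0 < t n := Nat.one_div_pos_of_nat
  choose x hx hnorm using fun n => exists_unit_norm_apply_eq_norm (A - (t n : 𝕜) • C)
  have hA (n : ℕ) : ‖A‖ ≤ ‖A (x n) - (t n : 𝕜) • C (x n)‖ := (h _ (ht n)).trans (hnorm n).ge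
  have hre (n : ℕ) : 2 * RCLike.re ⟪C (x n), A (x n)⟫_𝕜 ≤ t n * ‖C (x n)‖ ^ 2 := by
    have hle : ‖A (x n)‖ ^ 2 ≤ ‖A (x n) - (t n : 𝕜) • C (x n)‖ ^ 2 := by
      gcongr
      exact (A.unit_le_opNorm _ (hx n).le).trans (hA n)
    rw [norm_sub_sq (𝕜 := 𝕜), inner_smul_right, RCLike.re_ofReal_mul, inner_re_symm, norm_smul,
      RCLike.norm_of_nonneg (ht n).le] at hle
    refine le_of_mul_le_mul_left ?_ (ht n)
    linarith
  -- A limit point of unit vectors norming `A - t C`, as `t → 0`, norms `A`.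
  obtain ⟨a, ha, n, hn, hlim⟩ := (isCompact_sphere (0 : E) 1).tendsto_subseq
    fun n => mem_sphere_zero_iff_norm.2 (hx n)
  have ht₀ : Tendsto (fun i => t (n i)) atTop (𝓝 0) :=
    (tendsto_one_div_add_atTop_nhds_zero_nat (𝕜 := ℝ)).comp hn.tendsto_atTop
  have hAlim : Tendsto (fun i => A (x (n i))) atTop (𝓝 (A a)) := (A.continuous.tendsto a).comp hlim
  have hClim : Tendsto (fun i => C (x (n i))) atTop (𝓝 (C a)) := (C.continuous.tendsto a).comp hlim
  rw [mem_sphere_zero_iff_norm] at ha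
  refine ⟨a, ha, (A.unit_le_opNorm a ha.le).antisymm ?_, ?_⟩
  · have htC : Tendsto (fun i => (t (n i) : 𝕜) • C (x (n i))) atTop (𝓝 0) := by
      simpa using (((RCLike.continuous_ofReal (K := 𝕜)).tendsto 0).comp ht₀).smul hClim
    simpa using ge_of_tendsto' (hAlim.sub htC).norm fun i => hA (n i)
  · have hlim_re := ((RCLike.continuous_re.tendsto _).comp (hClim.inner (𝕜 := 𝕜) hAlim)).const_mul 2
    have hlim_t := ht₀.mul (hClim.norm.pow 2)
    have := le_of_tendsto_of_tendsto' hlim_re hlim_t fun i => hre (n i)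
    linarith

variable [InnerProductSpace 𝕜 E] [InnerProductSpace 𝕜 F]

/-- The vectors at which `A` attains its norm. By the parallelogram law in `E` and in `F` they form
a subspace. -/
def normAttainingSubspace (A : E →L[𝕜] F) : Submodule 𝕜 E where
  carrier := {x | ‖A x‖ = ‖A‖ * ‖x‖}
  zero_mem' := by simp
  smul_mem' c x hx := by
    simp only [Set.mem_ofPred_eq] at hx ⊢
    rw [map_smul, norm_smul, norm_smul, hx, mul_left_comm]
  add_mem' {x y} hx hy := by
    simp only [Set.mem_ofPred_eq] at hx hy ⊢
    have hsq (z : E) : ‖A z‖ ^ 2 ≤ (‖A‖ * ‖z‖) ^ 2 := by gcongr; exact A.le_opNorm z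
    have hE := parallelogram_law_with_norm 𝕜 x y
    have hF := parallelogram_law_with_norm 𝕜 (A x) (A y)
    refine (A.le_opNorm _).antisymm (le_of_sq_le_sq ?_ (norm_nonneg _))
    have hsub := hsq (x - y)
    rw [map_sub] at hsub
    rw [hx, hy] at hF
    rw [map_add]
    linear_combination hsub + ‖A‖ ^ 2 * hE - hF

theorem mem_normAttainingSubspace {A : E →L[𝕜] F} {x : E} :
    x ∈ normAttainingSubspace A ↔ ‖A x‖ = ‖A‖ * ‖x‖ :=
  Iff.rfl

end NormAttaining

section BhatiaSemrl

variable {E F : Type*} [NormedAddCommGroup E] [InnerProductSpace ℂ E]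
  [NormedAddCommGroup F] [InnerProductSpace ℂ F]

theorem exists_norming_inner_eq_zero [Nontrivial E] [FiniteDimensional ℂ E]
    {A B : E →L[ℂ] F} (h : ∀ μ : ℂ, ‖A‖ ≤ ‖A + μ • B‖) :
    ∃ x : E, ‖x‖ = 1 ∧ ‖A x‖ = ‖A‖ ∧ ⟪B x, A x⟫_ℂ = 0 := by
  let K : Submodule ℂ E := normAttainingSubspace A
  have : ProperSpace K := FiniteDimensional.proper_rclike ℂ K
  let φ : K →ₗ⋆[ℂ] K →ₗ[ℂ] ℂ :=
    ((innerₛₗ ℂ).comp (B ∘L K.subtypeL).toLinearMap).compl₂ (A ∘L K.subtypeL).toLinearMap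
  have hφ (x : K) : φ x x = ⟪B x, A x⟫_ℂ := rfl
  have hcompact : IsCompact (numericalRange φ) :=
    (isCompact_sphere 0 1).image (by simp only [hφ]; fun_prop)
  obtain ⟨x, hx, hφx : φ x x = 0⟩ : 0 ∈ numericalRange φ := by
    refine zero_mem_of_forall_exists_inner_nonpos hcompact.isComplete (convex_numericalRange φ)
      fun v => ?_
    obtain ⟨x, hx, hnorm, hre⟩ : ∃ x : E, ‖x‖ = 1 ∧ ‖A x‖ = ‖A‖ ∧ (⟪(v • B) x, A x⟫_ℂ).re ≤ 0 :=
      exists_norming_re_inner_nonpos fun t _ => by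
        simpa only [neg_smul, ← sub_eq_add_neg, mul_smul] using h (-((RCLike.ofReal t : ℂ) * v))
    have hxK : x ∈ K := mem_normAttainingSubspace.2 (by rw [hnorm, hx, mul_one])
    refine ⟨⟪B x, A x⟫_ℂ, ⟨⟨x, hxK⟩, mem_sphere_zero_iff_norm.2 hx, rfl⟩, ?_⟩
    rwa [smul_apply, inner_smul_left, mul_comm] at hre
  have hx : ‖(x : E)‖ = 1 := mem_sphere_zero_iff_norm.1 hx
  exact ⟨x, hx, by rw [mem_normAttainingSubspace.1 x.2, hx, mul_one], hφx⟩

theorem exists_norm_add_smul_le_of_finiteDimensional [FiniteDimensional ℂ E] {A B : E →L[ℂ] F}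
    {s : ℝ} (hs : 0 ≤ s) (h : ∀ x : E, ‖x‖ = 1 → ∃ μ : ℂ, ‖A x + μ • B x‖ ≤ s) :
    ∃ μ : ℂ, ‖A + μ • B‖ ≤ s := by
  cases subsingleton_or_nontrivial E
  · exact ⟨0, by rw [ContinuousLinearMap.opNorm_subsingleton]; exact hs⟩
  obtain ⟨μ, hμ⟩ := exists_forall_norm_add_smul_le ℂ A B
  obtain ⟨x, hx, hnorm, horth⟩ : ∃ x : E, ‖x‖ = 1 ∧ ‖(A + μ • B) x‖ = ‖A + μ • B‖ ∧
      ⟪B x, (A + μ • B) x⟫_ℂ = 0 :=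
    exists_norming_inner_eq_zero fun ν => by
      rw [add_assoc, ← add_smul]
      exact hμ _
  obtain ⟨ν, hν⟩ := h x hx
  refine ⟨μ, ?_⟩
  calc ‖A + μ • B‖ = ‖(A + μ • B) x‖ := hnorm.symm
    _ ≤ ‖(A + μ • B) x + (ν - μ) • B x‖ := norm_le_norm_add_smul_of_inner_eq_zero horth _
    _ = ‖A x + ν • B x‖ := by simp [sub_smul]
    _ ≤ s := hν

theorem exists_norm_add_smul_le_of_forall_unit {A B : E →L[ℂ] F} {s : ℝ} (hs : 0 ≤ s)
    (h : ∀ x : E, ‖x‖ = 1 → ∃ μ : ℂ, ‖A x + μ • B x‖ ≤ s) :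
    ∃ μ : ℂ, ‖A + μ • B‖ ≤ s := by
  rcases eq_or_ne B 0 with rfl | hB
  · exact ⟨0, ContinuousLinearMap.opNorm_le_of_unit_norm hs fun x hx => by simpa using h x hx⟩
  obtain ⟨x₀, hx₀⟩ : ∃ x₀, B x₀ ≠ 0 := DFunLike.ne_iff.1 hB
  let M (x : E) : Set ℂ := {μ | ‖A x + μ • B x‖ ≤ s * ‖x‖}
  have hclosed (x : E) : IsClosed (M x) := isClosed_le (by fun_prop) continuous_const
  have hfinite (X : Finset E) : (M x₀ ∩ ⋂ x ∈ X, M x).Nonempty := by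
    let K : Submodule ℂ E := Submodule.span ℂ (insert x₀ (X : Set E))
    have : FiniteDimensional ℂ K := .span_of_finite ℂ (X.finite_toSet.insert x₀)
    obtain ⟨μ, hμ⟩ : ∃ μ : ℂ, ‖A ∘L K.subtypeL + μ • B ∘L K.subtypeL‖ ≤ s :=
      exists_norm_add_smul_le_of_finiteDimensional hs fun x hx => h x hx
    have hK (x : E) (hx : x ∈ insert x₀ (X : Set E)) : μ ∈ M x :=
      (A ∘L K.subtypeL + μ • B ∘L K.subtypeL).le_of_opNorm_le hμ ⟨x, Submodule.subset_span hx⟩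
    exact ⟨μ, hK _ (Set.mem_insert _ _),
      Set.mem_iInter₂.2 fun x hx => hK x (Set.mem_insert_of_mem _ hx)⟩
  obtain ⟨μ, -, hμ⟩ := (isCompact_setOf_norm_add_smul_le (A x₀) hx₀ _).inter_iInter_nonempty M
    hclosed hfinite
  exact ⟨μ, ContinuousLinearMap.opNorm_le_bound _ hs fun x => Set.mem_iInter.1 hμ x⟩

end BhatiaSemrl

section Operators

variable {H : Type*} [NormedAddCommGroup H] [InnerProductSpace ℂ H] {T₁ T₂ : H →L[ℂ] H}

theorem ApproxParallel.reverseCauchySchwarz {ε : ℝ} (h : ApproxParallel ε T₁ T₂) :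
    ReverseCauchySchwarz ε T₁ T₂ := by
  intro ξ hξ
  obtain ⟨μ, hμ⟩ := approxParallel_iff_exists_norm_add_smul_le.1 h
  have hξμ : ‖T₁ ξ + μ • T₂ ξ‖ ≤ ε * ‖T₁‖ := ((T₁ + μ • T₂).unit_le_opNorm ξ hξ.le).trans hμ
  have hbound : ‖T₁ ξ‖ ^ 2 * ‖T₂ ξ‖ ^ 2 - ‖⟪T₂ ξ, T₁ ξ⟫_ℂ‖ ^ 2 ≤ ε ^ 2 * ‖T₁‖ ^ 2 * ‖T₂‖ ^ 2 :=
    calc ‖T₁ ξ‖ ^ 2 * ‖T₂ ξ‖ ^ 2 - ‖⟪T₂ ξ, T₁ ξ⟫_ℂ‖ ^ 2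
        ≤ ‖T₁ ξ + μ • T₂ ξ‖ ^ 2 * ‖T₂ ξ‖ ^ 2 := norm_sq_mul_norm_sq_sub_norm_inner_sq_le _ _ μ
      _ ≤ (ε * ‖T₁‖) ^ 2 * ‖T₂‖ ^ 2 := by gcongr; exact T₂.unit_le_opNorm ξ hξ.le
      _ = ε ^ 2 * ‖T₁‖ ^ 2 * ‖T₂‖ ^ 2 := by rw [mul_pow]
  linarith

theorem bddAbove_orthValues (T₁ T₂ : H →L[ℂ] H) : BddAbove (orthValues T₁ T₂) := by
  refine ⟨‖T₁‖, ?_⟩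
  rintro _ ⟨ξ, η, hξ, hη, -, rfl⟩
  exact norm_inner_apply_le_opNorm T₁ hξ hη

theorem sSup_orthValues_le_iff {s : ℝ} (hs : 0 ≤ s) :
    sSup (orthValues T₁ T₂) ≤ s ↔ ∃ μ : ℂ, ‖T₁ + μ • T₂‖ ≤ s := by
  constructor
  · intro h
    refine exists_norm_add_smul_le_of_forall_unit hs fun ξ hξ =>
      exists_norm_add_smul_le_of_norm_inner_le hs fun η hη horth => ?_
    exact (le_csSup (bddAbove_orthValues T₁ T₂) ⟨ξ, η, hξ, hη, horth, rfl⟩).trans h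
  · rintro ⟨μ, hμ⟩
    refine Real.sSup_le ?_ hs
    rintro _ ⟨ξ, η, hξ, hη, horth, rfl⟩
    have heq : ⟪η, T₁ ξ⟫_ℂ = ⟪η, (T₁ + μ • T₂) ξ⟫_ℂ := by
      rw [add_apply, smul_apply, inner_add_right, inner_smul_right, horth, mul_zero, add_zero]
    rw [heq]
    exact (norm_inner_apply_le_opNorm _ hξ hη).trans hμ

theorem approxParallel_adjoint_iff [CompleteSpace H] {ε : ℝ} :
    ApproxParallel ε (ContinuousLinearMap.adjoint T₁) (ContinuousLinearMap.adjoint T₂) ↔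
      ApproxParallel ε T₁ T₂ :=
  approxParallel_map_conjLinear_iff
    (ContinuousLinearMap.adjoint : (H →L[ℂ] H) ≃ₗᵢ⋆[ℂ] (H →L[ℂ] H))

end Operators

theorem mainTheorem2 {H : Type*} [NormedAddCommGroup H] [InnerProductSpace ℂ H] [CompleteSpace H]
    (T₁ T₂ : H →L[ℂ] H) (ε : ℝ) (hε : ε ∈ Set.Ico (0 : ℝ) 1) :
    List.TFAE [
      ApproxParallel ε T₁ T₂,
      ApproxParallel ε (ContinuousLinearMap.adjoint T₁) (ContinuousLinearMap.adjoint T₂),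
      ∀ α β : ℂ, α ≠ 0 → β ≠ 0 → ApproxParallel ε (α • T₁) (β • T₂),
      ∃ α β : ℂ, α ≠ 0 ∧ β ≠ 0 ∧ ApproxParallel ε (α • T₁) (β • T₂),
      sSup (orthValues T₁ T₂) ≤ ε * ‖T₁‖] ∧
    (ApproxParallel ε T₁ T₂ → ReverseCauchySchwarz ε T₁ T₂) ∧
    (ApproxParallel ε (ContinuousLinearMap.adjoint T₁) (ContinuousLinearMap.adjoint T₂) →
      ReverseCauchySchwarz ε T₁ T₂) ∧
    (∀ α β : ℂ, α ≠ 0 → β ≠ 0 → ApproxParallel ε (α • T₁) (β • T₂) →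
      ReverseCauchySchwarz ε T₁ T₂) ∧
    (sSup (orthValues T₁ T₂) ≤ ε * ‖T₁‖ → ReverseCauchySchwarz ε T₁ T₂) := by
  have orth_iff : sSup (orthValues T₁ T₂) ≤ ε * ‖T₁‖ ↔ ApproxParallel ε T₁ T₂ :=
    (sSup_orthValues_le_iff (mul_nonneg hε.1 (norm_nonneg T₁))).trans
      approxParallel_iff_exists_norm_add_smul_le.symm
  refine ⟨?_, fun h => h.reverseCauchySchwarz,
    fun h => (approxParallel_adjoint_iff.1 h).reverseCauchySchwarz,
    fun _ _ hα hβ h => ((approxParallel_smul_smul_iff hα hβ).1 h).reverseCauchySchwarz,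
    fun h => (orth_iff.1 h).reverseCauchySchwarz⟩
  tfae_have 2 ↔ 1 := approxParallel_adjoint_iff
  tfae_have 5 ↔ 1 := orth_iff
  tfae_have 1 → 3 := fun h _ _ hα hβ => (approxParallel_smul_smul_iff hα hβ).2 h
  tfae_have 3 → 4 := fun h => ⟨1, 1, one_ne_zero, one_ne_zero, h 1 1 one_ne_zero one_ne_zero⟩
  tfae_have 4 → 1 := fun ⟨_, _, hα, hβ, h⟩ => (approxParallel_smul_smul_iff hα hβ).1 h
  tfae_finish
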